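/- Let $d$ and $n$ be positive integers. An $n$-partition of $\mathbb{R}^d$ is a list $\mathcal{P}=(P_1,\dots,P_n)$ of nonempty, open, convex, pairwise disjoint subsets of $\mathbb{R}^d$ with $\bigcup_{i=1}^n\overline{P_i}=\mathbb{R}^d$. Let $S^d=\{v=(v_0,\dots,v_d)\in\mathbb{R}^{d+1}:\|v\|=1\}$, let $S^d_+$ and $S^d_-$ be its open hemispheres $\{v_0>0\}$ and $\{v_0<0\}$, and for $x\in\mathbb{R}^d$ put $\widehat{x}=(1,x)/\sqrt{1+\|x\|^2}\in S^d_+$. The spherical representation of $\mathcal{P}$ is the list of the sets $\widehat P_i=\{\widehat x: x\in P_i\}$, $i=1,\dots,n$, together with $\widehat P_\infty=S^d_-$. For $x\in\mathbb{R}^{d+1}$ let $$I(x)=\{i\in\{1,\dots,n,\infty\}: x=\lambda a\text{ for some }\lambda\ge 0\text{ and } a\in\overline{\widehat P_i}\},$$ and for a set $I$ of indices let $F_I=\bigcap_{i\in I}\overline{\widehat P_i}\subseteq S^d$. The faces of $\mathcal{P}$ are the sets $F_{I(x)}$, where $x\in\mathbb{R}^{d+1}$ and $I(x)\ne\{\infty\}$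 (so $F_{\{\infty\}}=\overline{S^d_-}$ is not a face of $\mathcal{P}$). The partition $\mathcal{P}$ is essential if $F_{I(0)}=\emptyset$. Theorem. If $\mathcal{P}$ is an essential $n$-partition of $\mathbb{R}^d$, then the nonempty faces of $\mathcal{P}$ are the closed cells of a regular CW complex whose underlying space is the closed upper hemisphere $\overline{S^d_+}$. That is, $\overline{S^d_+}$ (with its usual topology) has a CW structure in which every characteristic map is injective on the closed ball, and such that assigning to each cell its closed cell is a bijection from the set of cells onto the set of nonempty faces of $\mathcal{P}$. -/

import Mathlib

noncomputable section

namespace ConvexPartition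

/-- A convex partition of `ℝ^d` into `n` regions: a list of nonempty open convex sets that are
pairwise disjoint and whose closures cover `ℝ^d`. -/
structure IsConvexPartition {d n : ℕ} (P : Fin n → Set (EuclideanSpace ℝ (Fin d))) : Prop where
  nonempty : ∀ i, (P i).Nonempty
  isOpen : ∀ i, IsOpen (P i)
  convex : ∀ i, Convex ℝ (P i)
  pairwise_disjoint : Pairwise (fun i j => Disjoint (P i) (P j))
  iUnion_closure : ⋃ i, closure (P i) = Set.univ

/-- The unit sphere `S^d` in `ℝ^{d+1}`; the coordinates are `v 0, …, v d`. -/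
def unitSphere (d : ℕ) : Set (EuclideanSpace ℝ (Fin (d + 1))) :=
  Metric.sphere 0 1

/-- The open upper hemisphere `S^d_+`. -/
def upperHemisphere (d : ℕ) : Set (EuclideanSpace ℝ (Fin (d + 1))) :=
  {v | v ∈ unitSphere d ∧ 0 < v 0}

/-- The open lower hemisphere `S^d_-`. -/
def lowerHemisphere (d : ℕ) : Set (EuclideanSpace ℝ (Fin (d + 1))) :=
  {v | v ∈ unitSphere d ∧ v 0 < 0}

/-- The point `x̂ = (1, x) / √(1 + ‖x‖²)` of the upper hemisphere. -/
def hat {d : ℕ} (x : EuclideanSpace ℝ (Fin d)) : EuclideanSpace ℝ (Fin (d + 1)) :=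
  (1 / Real.sqrt (1 + ‖x‖ ^ 2)) • WithLp.toLp 2 (Fin.cons (1 : ℝ) (fun i => x i))

/-- The spherical representation of an `n`-partition. The regions are indexed by `Option (Fin n)`;
the index `none` plays the role of `∞`. -/
def sphericalRep {d n : ℕ} (P : Fin n → Set (EuclideanSpace ℝ (Fin d))) :
    Option (Fin n) → Set (EuclideanSpace ℝ (Fin (d + 1)))
  | some i => hat '' P i
  | none => lowerHemisphere d

/-- The cone over a set: the union of the closed rays from the origin through its points
(the empty set has empty cone). -/
def cone {d : ℕ} (A : Set (EuclideanSpace ℝ (Fin (d + 1)))) :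
    Set (EuclideanSpace ℝ (Fin (d + 1))) :=
  {y | ∃ r : ℝ, 0 ≤ r ∧ ∃ a ∈ A, y = r • a}

/-- The index set `I(x)` of a point `x ∈ ℝ^{d+1}` for a list `Q` of subsets of `S^d`. As `S^d` is
closed in `ℝ^{d+1}`, closures in `S^d` and in `ℝ^{d+1}` agree. -/
def indexSet {d : ℕ} {ι : Type} (Q : ι → Set (EuclideanSpace ℝ (Fin (d + 1))))
    (x : EuclideanSpace ℝ (Fin (d + 1))) : Set ι :=
  {i | x ∈ cone (closure (Q i))}

/-- The set `F_I ⊆ S^d`, the intersection of the closures of the `Q i` with `i ∈ I`. -/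
def sphericalFace {d : ℕ} {ι : Type} (Q : ι → Set (EuclideanSpace ℝ (Fin (d + 1))))
    (I : Set ι) : Set (EuclideanSpace ℝ (Fin (d + 1))) :=
  unitSphere d ∩ ⋂ i ∈ I, closure (Q i)

/-- The faces of an `n`-partition `P` of `ℝ^d`: all sets `F_{I(x)}`, `x ∈ ℝ^{d+1}`, of the
spherical representation, with the exception of `F_{∞}` (the closed lower hemisphere). -/
def faces {d n : ℕ} (P : Fin n → Set (EuclideanSpace ℝ (Fin d))) :
    Set (Set (EuclideanSpace ℝ (Fin (d + 1)))) :=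
  {F | ∃ x : EuclideanSpace ℝ (Fin (d + 1)), indexSet (sphericalRep P) x ≠ {none} ∧
    F = sphericalFace (sphericalRep P) (indexSet (sphericalRep P) x)}

/-- An `n`-partition is essential if `F_{I(0)} = ∅`. -/
def IsEssential {d n : ℕ} (P : Fin n → Set (EuclideanSpace ℝ (Fin d))) : Prop :=
  sphericalFace (sphericalRep P) (indexSet (sphericalRep P) 0) = ∅

/-- A CW complex (in a Hausdorff space) is regular if all its characteristic maps are injective on
the closed ball, that is, are homeomorphisms from the closed ball onto the closed cell. -/
def IsRegularCW {X : Type*} [TopologicalSpace X] [T2Space X] (C : Set X)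
    [Topology.CWComplex C] : Prop :=
  ∀ (k : ℕ) (e : Topology.RelCWComplex.cell C k),
    Set.InjOn (Topology.RelCWComplex.map k e) (Metric.closedBall 0 1)

end ConvexPartition

end

/-! Pass to `ℝ^{d+1}`: the open cones over the spherical regions, with the lower half-space for `∞`,
are disjoint, open and convex, and their closures cover the space. Then `I(x)` is the set of closed
cones touching `x` (`contact`), and `F_{I(x)}` is the trace on the sphere of the closed convex cone
`stratum O x`.

The crux is that the relative interior of a stratum consists exactly of the points with the same
contact set (`mem_interior_stratum_iff`). Everything rests on `exists_mem_closure_of_leave`, a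
crossing-segments argument using convexity and disjointness. Consequently the open cells are the
classes of unit vectors with equal contact sets, and passing to a strictly larger contact set lowers
the dimension of the span (`finrank_span_stratum_lt`), so cell boundaries lie in cells of lower
dimension.

Essentiality says that no unit vector touches every cone. Hence `0` is not in the relative interior
of the stratum of a unit vector `x`, so `-x` is not in that stratum, and its trace on the sphere is
a closed ball (`exists_ball_param`). -/

namespace ConvexPartition
open Set Filter Topology

/-! ### Contact sets and strata of open convex covers -/

section Covers

variable {E ι : Type*} [NormedAddCommGroup E]

/-- The indices of the members of a family whose closures contain `x`. -/
def contact (O : ι → Set E) (x : E) : Set ι := {i | x ∈ closure (O i)}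

/-- The intersection of the closures of all members of a family that touch `x`. -/
def stratum (O : ι → Set E) (x : E) : Set E := {y | contact O x ⊆ contact O y}

lemma mem_stratum {O : ι → Set E} {x y : E} : y ∈ stratum O x ↔ contact O x ⊆ contact O y := Iff.rfl

lemma self_mem_stratum (O : ι → Set E) (x : E) : x ∈ stratum O x := Subset.rfl

lemma stratum_eq_iInter (O : ι → Set E) (x : E) :
    stratum O x = ⋂ i ∈ contact O x, closure (O i) := by
  ext y
  simp [stratum, contact, subset_def]

lemma isClosed_stratum (O : ι → Set E) (x : E) : IsClosed (stratum O x) := by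
  rw [stratum_eq_iInter]
  exact isClosed_biInter fun _ _ => isClosed_closure

lemma stratum_congr {O : ι → Set E} {x y : E} (h : contact O x = contact O y) :
    stratum O x = stratum O y := by
  simp only [stratum, h]

lemma eventually_contact_subset [Finite ι] (O : ι → Set E) (x : E) :
    ∀ᶠ y in 𝓝 x, contact O y ⊆ contact O x := by
  have h : ∀ i, ∀ᶠ y in 𝓝 x, y ∈ closure (O i) → x ∈ closure (O i) := by
    intro i
    by_cases hx : x ∈ closure (O i)
    · exact Eventually.of_forall fun _ _ => hx
    · filter_upwards [isClosed_closure.isOpen_compl.mem_nhds hx] with y hy hy'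
      exact absurd hy' hy
  filter_upwards [eventually_all.2 h] with y hy i hi using hy i hi

variable [NormedSpace ℝ E]

/-- Open convex sets that are pairwise disjoint and whose closures cover the space. -/
structure IsOpenConvexCover (O : ι → Set E) : Prop where
  isOpen : ∀ i, IsOpen (O i)
  convex : ∀ i, Convex ℝ (O i)
  disjoint : Pairwise (fun i j => Disjoint (O i) (O j))
  cover : ⋃ i, closure (O i) = univ

namespace IsOpenConvexCover

variable {O : ι → Set E} (hO : IsOpenConvexCover O)
include hO

lemma convex_stratum (x : E) : Convex ℝ (stratum O x) := by
  rw [stratum_eq_iInter]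
  exact convex_iInter₂ fun i _ => (hO.convex i).closure

lemma combo_mem (i : ι) {p q : E} (hp : p ∈ O i) (hq : q ∈ closure (O i)) {a b : ℝ} (ha : 0 < a)
    (hb : 0 ≤ b) (hab : a + b = 1) : a • p + b • q ∈ O i := by
  have h := (hO.convex i).combo_interior_closure_mem_interior
    (by rwa [(hO.isOpen i).interior_eq]) hq ha hb hab
  rwa [(hO.isOpen i).interior_eq] at h

variable [Finite ι]

/-- If a point leaves the closure of a region by a translation along `u`, then it enters
the closure of a region that does not extend in the direction of `-u`. -/
lemma exists_mem_closure_of_leave {i : ι} {p u : E} (hp : p ∈ closure (O i))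
    (hpu : p + u ∉ closure (O i)) :
    ∃ j, p + u ∈ closure (O j) ∧ ∀ ε : ℝ, 0 < ε → p - ε • u ∉ closure (O j) := by
  have hnear : ∀ᶠ q in 𝓝 p, contact O (q + u) ⊆ contact O (p + u) :=
    (continuous_id.add continuous_const).continuousAt.eventually
      (eventually_contact_subset O (p + u))
  obtain ⟨U, hU, hUo, hpU⟩ := eventually_nhds_iff.1 hnear
  obtain ⟨q₀, hq₀U, hq₀⟩ := mem_closure_iff.1 hp U hUo hpU
  have hdense : closure (⋃ j, O j) = univ := by
    rw [closure_iUnion_of_finite, hO.cover]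
  -- By density of the union of the regions, some `z` near `q₀ + u` lies in a region `O j` while `z
  -- - u` still lies in `U ∩ O i`.
  have hW : IsOpen ((fun z => z - u) ⁻¹' (U ∩ O i)) :=
    (hUo.inter (hO.isOpen i)).preimage (continuous_id.sub continuous_const)
  have hmem : q₀ + u ∈ closure (⋃ j, O j) := hdense ▸ mem_univ _
  obtain ⟨z, hzW, hz⟩ := mem_closure_iff.1 hmem _ hW (by simpa using ⟨hq₀U, hq₀⟩)
  obtain ⟨j, hzj⟩ := mem_iUnion.1 hz
  have hpuj : p + u ∈ closure (O j) :=
    hU _ hzW.1 (by simpa [contact] using subset_closure hzj)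
  refine ⟨j, hpuj, fun ε hε hj => ?_⟩
  have hij : i ≠ j := by
    rintro rfl
    exact hpu hpuj
  -- With these weights the segments from `z - u` to `p` (in `O i`) and from `z` to `p - ε • u` (in
  -- `O j`) meet in one point.
  have h1 : 0 < ε / (1 + ε) := by positivity
  have h2 : 0 ≤ 1 / (1 + ε) := by positivity
  have h3 : ε / (1 + ε) + 1 / (1 + ε) = 1 := by field_simp; exact add_comm _ _
  have hi' := hO.combo_mem i hzW.2 hp h1 h2 h3
  have hj' := hO.combo_mem j hzj hj h1 h2 h3
  refine disjoint_left.1 (hO.disjoint hij) hi' ?_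
  convert hj' using 1
  match_scalars <;> field_simp

/-- A short step from `x` away from `y` meets only closures that contain `x`. If the step left one
of them, it would enter some `O j` whose closure misses `y`; but `j` touches `x`, hence also `y`. -/
lemma exists_extend {x y : E} (hy : y ∈ stratum O x) :
    ∃ ε : ℝ, 0 < ε ∧ x - ε • (y - x) ∈ stratum O x := by
  have hc : ContinuousAt (fun ε : ℝ => x - ε • (y - x)) 0 := by fun_prop
  have hev : ∀ᶠ ε : ℝ in 𝓝 0, contact O (x - ε • (y - x)) ⊆ contact O x := by
    have := eventually_contact_subset O x
    rw [show x = x - (0 : ℝ) • (y - x) by simp] at this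
    exact (hc.eventually this).mono fun ε h => by simpa using h
  obtain ⟨ε, hε, hε0⟩ := ((hev.filter_mono nhdsWithin_le_nhds).and
    (self_mem_nhdsWithin (s := Ioi (0 : ℝ)))).exists
  refine ⟨ε, hε0, fun i hi => ?_⟩
  by_contra hni
  have hε0' : 0 < ε := hε0
  obtain ⟨j, hj, hj'⟩ := hO.exists_mem_closure_of_leave (u := -(ε • (y - x))) hi
    (by rwa [← sub_eq_add_neg])
  rw [← sub_eq_add_neg] at hj
  refine hj' ε⁻¹ (by positivity) ?_
  have : x - ε⁻¹ • -(ε • (y - x)) = y := by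
    rw [smul_neg, smul_smul, inv_mul_cancel₀ hε0'.ne']; simp
  rw [this]
  exact hy (hε hj)

/-- A region touching `y` but not `x` is left on the way from `y` to `x`, so some region touching
`x` misses every point beyond `y`, contradicting `hz`. -/
lemma contact_eq_of_extend {x y : E} (hy : y ∈ stratum O x) {ε : ℝ} (hε : 0 < ε)
    (hz : y - ε • (x - y) ∈ stratum O x) : contact O y = contact O x := by
  refine Subset.antisymm (fun i hi => ?_) hy
  by_contra hni
  obtain ⟨j, hj, hj'⟩ := hO.exists_mem_closure_of_leave (u := x - y) hi
    (by simpa [contact] using hni)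
  exact hj' ε hε (hz (by simpa [contact] using hj))

end IsOpenConvexCover

/-- For a stratum containing the origin, the interior in the linear span consists of the points
with the same contact set. -/
lemma IsOpenConvexCover.mem_interior_stratum_iff [FiniteDimensional ℝ E] [Finite ι]
    {O : ι → Set E} (hO : IsOpenConvexCover O) {x : E} (h0 : 0 ∈ stratum O x) :
    ∀ y : Submodule.span ℝ (stratum O x),
    y ∈ interior ((↑) ⁻¹' stratum O x : Set (Submodule.span ℝ (stratum O x))) ↔
      contact O (y : E) = contact O x := by
  set V := Submodule.span ℝ (stratum O x) with hV
  set C : Set V := (↑) ⁻¹' stratum O x with hC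
  have hconv : Convex ℝ C := (hO.convex_stratum x).linear_preimage V.subtype
  -- Since `0` lies in the stratum, its affine span is its linear span.
  have hne : (interior C).Nonempty := by
    rw [hconv.interior_nonempty_iff_affineSpan_eq_top,
      AffineSubspace.affineSpan_eq_top_iff_vectorSpan_eq_top_of_nonempty ℝ V V ⟨0, by simpa [hC] using h0⟩,
      vectorSpan_eq_span_vsub_set_right ℝ (p := (0 : V)) (by simpa [hC] using h0)]
    have := Submodule.span_span_coe_preimage (R := ℝ) (s := stratum O x)
    simp only [vsub_eq_sub, sub_zero, image_id']
    exact this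
  intro y
  constructor
  · intro hy
    have hxV : x ∈ V := Submodule.subset_span (self_mem_stratum O x)
    have hc : ContinuousAt (fun ε : ℝ => y - ε • (⟨x, hxV⟩ - y)) 0 := by fun_prop
    have hev : ∀ᶠ ε : ℝ in 𝓝 0, y - ε • (⟨x, hxV⟩ - y) ∈ interior C := by
      apply hc.eventually_mem
      simpa using isOpen_interior.mem_nhds hy
    obtain ⟨ε, hε, hε0⟩ := ((hev.filter_mono nhdsWithin_le_nhds).and
      (self_mem_nhdsWithin (s := Ioi (0 : ℝ)))).exists
    exact hO.contact_eq_of_extend (show y ∈ C from interior_subset hy) hε0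
      (show _ ∈ C from interior_subset hε)
  · intro hy
    obtain ⟨z, hz⟩ := hne
    obtain ⟨ε, hε, h⟩ := hO.exists_extend (x := (y : E)) (y := z)
      (by rw [stratum_congr hy]; exact (show z ∈ C from interior_subset hz))
    have hw : y - ε • (z - y) ∈ C := by
      rw [stratum_congr hy] at h
      exact h
    have h1 : 0 < ε / (1 + ε) := by positivity
    have h2 : 0 ≤ 1 / (1 + ε) := by positivity
    have h3 : ε / (1 + ε) + 1 / (1 + ε) = 1 := by field_simp; ring
    convert hconv.combo_interior_self_mem_interior hz hw h1 h2 h3 using 1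
    match_scalars <;> field_simp
    all_goals ring

end Covers

end ConvexPartition

namespace ConvexPartition
open Set Filter Topology

/-! ### Spherical traces of closed convex cones are balls -/

section ConeBall

variable {V : Type*} [NormedAddCommGroup V] [NormedSpace ℝ V]

/-- How far one can move from `y` in the direction of `-x` before leaving `C`. -/
noncomputable def depth (C : Set V) (x y : V) : ℝ := sSup {t : ℝ | y - t • x ∈ C}

/-- A closed convex cone (the empty set is allowed). -/
structure IsClosedConvexCone (C : Set V) : Prop where
  isClosed : IsClosed C
  convex : Convex ℝ C
  smul_mem : ∀ r : ℝ, 0 < r → ∀ y ∈ C, r • y ∈ C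

namespace IsClosedConvexCone

variable {C : Set V} (hC : IsClosedConvexCone C) {x : V}
include hC

lemma add_mem {a b : V} (ha : a ∈ C) (hb : b ∈ C) : a + b ∈ C := by
  have h := hC.smul_mem 2 two_pos _ (hC.convex ha hb (a := 1 / 2) (b := 1 / 2)
    (by norm_num) (by norm_num) (by norm_num))
  simpa [smul_smul] using h

lemma smul_mem_iff {r : ℝ} (hr : 0 < r) {y : V} : r • y ∈ C ↔ y ∈ C := by
  refine ⟨fun h => ?_, hC.smul_mem r hr y⟩
  simpa [smul_smul, hr.ne'] using hC.smul_mem r⁻¹ (by positivity) _ h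

lemma add_mem_interior {a b : V} (ha : a ∈ C) (hb : b ∈ interior C) : a + b ∈ interior C := by
  have hopen : IsOpen ((fun z => z - a) ⁻¹' interior C) :=
    isOpen_interior.preimage (continuous_id.sub continuous_const)
  refine interior_maximal (fun z hz => ?_) hopen (by simpa using hb)
  simpa using hC.add_mem ha (interior_subset hz)

lemma smul_mem_interior {r : ℝ} (hr : 0 < r) {y : V} (hy : y ∈ interior C) :
    r • y ∈ interior C := by
  have hopen : IsOpen ((fun z => r⁻¹ • z) ⁻¹' interior C) :=
    isOpen_interior.preimage (continuous_const_smul _)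
  refine interior_maximal (fun z hz => ?_) hopen (by simpa [smul_smul, hr.ne'] using hy)
  exact (hC.smul_mem_iff (inv_pos.2 hr)).1 (interior_subset hz)

lemma neg_notMem (hx : x ∈ interior C) (h0 : 0 ∉ interior C) : -x ∉ C := fun h =>
  h0 (by simpa using hC.add_mem_interior h hx)

variable (hx : x ∈ interior C) (hx' : -x ∉ C)
include hx hx'

/-- The admissible `t` form a closed set that is closed downwards (add multiples of `x`), nonempty
because `x` is interior, and bounded above because `-x` is outside the closed set `C`. It is
therefore a half-line ending at its supremum. -/
lemma sub_smul_mem_iff (y : V) (t : ℝ) : y - t • x ∈ C ↔ t ≤ depth C x y := by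
  set T := {t : ℝ | y - t • x ∈ C} with hT
  have hdown : ∀ s ∈ T, ∀ t, t < s → t ∈ T := by
    intro s hs t hts
    have := hC.add_mem hs (hC.smul_mem (s - t) (sub_pos.2 hts) x (interior_subset hx))
    simp only [hT, mem_ofPred_eq]
    convert this using 1
    module
  have hclosed : IsClosed T := hC.isClosed.preimage (by fun_prop)
  have hne : T.Nonempty := by
    have hev : ∀ᶠ r : ℝ in 𝓝 0, x + r • y ∈ interior C := by
      apply ContinuousAt.eventually_mem (by fun_prop)
      simpa using isOpen_interior.mem_nhds hx
    obtain ⟨r, hr, hr0⟩ := ((hev.filter_mono nhdsWithin_le_nhds).and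
      (self_mem_nhdsWithin (s := Ioi (0 : ℝ)))).exists
    have hr0' : 0 < r := hr0
    refine ⟨-r⁻¹, ?_⟩
    have := hC.smul_mem r⁻¹ (by positivity) _ (interior_subset hr)
    simp only [hT, mem_ofPred_eq]
    convert this using 1
    match_scalars <;> field_simp
  have hbdd : BddAbove T := by
    have hev : ∀ᶠ r : ℝ in 𝓝 0, -x + r • y ∈ Cᶜ := by
      apply ContinuousAt.eventually_mem (by fun_prop)
      simpa using hC.isClosed.isOpen_compl.mem_nhds hx'
    obtain ⟨r, hr, hr0⟩ := ((hev.filter_mono nhdsWithin_le_nhds).and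
      (self_mem_nhdsWithin (s := Ioi (0 : ℝ)))).exists
    have hr0' : 0 < r := hr0
    refine ⟨r⁻¹, fun s hs => ?_⟩
    by_contra hlt
    have := hC.smul_mem r hr0' _ (hdown s hs r⁻¹ (not_le.1 hlt))
    refine hr ?_
    convert this using 1
    match_scalars <;> field_simp
  refine ⟨fun h => le_csSup hbdd h, fun h => ?_⟩
  have hmax : depth C x y ∈ T := hclosed.csSup_mem hne hbdd
  rcases h.eq_or_lt with rfl | h
  · exact hmax
  · exact hdown _ hmax t h

lemma mem_iff_depth (y : V) : y ∈ C ↔ 0 ≤ depth C x y := by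
  simpa using hC.sub_smul_mem_iff hx hx' y 0

lemma depth_add_smul (y : V) (s : ℝ) : depth C x (y + s • x) = depth C x y + s := by
  refine eq_of_forall_le_iff fun t => ?_
  rw [← hC.sub_smul_mem_iff hx hx', ← sub_le_iff_le_add, ← hC.sub_smul_mem_iff hx hx']
  have : y + s • x - t • x = y - (t - s) • x := by module
  rw [this]

lemma depth_smul {r : ℝ} (hr : 0 < r) (y : V) : depth C x (r • y) = r * depth C x y := by
  refine eq_of_forall_le_iff fun t => ?_
  rw [← hC.sub_smul_mem_iff hx hx', ← div_le_iff₀' hr, ← hC.sub_smul_mem_iff hx hx',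
    ← hC.smul_mem_iff hr (y := y - _)]
  have : r • (y - (t / r) • x) = r • y - t • x := by match_scalars <;> field_simp
  rw [this]

lemma depth_zero : depth C x 0 = 0 := by
  have := hC.depth_smul hx hx' two_pos 0
  rw [smul_zero] at this
  linarith

lemma sub_smul_mem_interior_iff (y : V) (t : ℝ) :
    y - t • x ∈ interior C ↔ t < depth C x y := by
  constructor
  · intro h
    have hev : ∀ᶠ r : ℝ in 𝓝 t, y - r • x ∈ interior C := by
      apply ContinuousAt.eventually_mem (by fun_prop)
      exact isOpen_interior.mem_nhds h
    obtain ⟨r, hr, hr0⟩ := ((hev.filter_mono nhdsWithin_le_nhds).and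
      (self_mem_nhdsWithin (s := Ioi t))).exists
    exact lt_of_lt_of_le hr0 ((hC.sub_smul_mem_iff hx hx' y r).1 (interior_subset hr))
  · intro h
    have := hC.add_mem_interior ((hC.sub_smul_mem_iff hx hx' y _).2 le_rfl)
      (hC.smul_mem_interior (sub_pos.2 h) hx)
    convert this using 1
    module

lemma mem_interior_iff_depth (y : V) : y ∈ interior C ↔ 0 < depth C x y := by
  simpa using hC.sub_smul_mem_interior_iff hx hx' y 0

lemma continuous_depth : Continuous (depth C x) := by
  rw [OrderTopology.continuous_iff]
  intro t
  constructor
  · have : depth C x ⁻¹' Ioi t = (fun y => y - t • x) ⁻¹' interior C := by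
      ext y; exact (hC.sub_smul_mem_interior_iff hx hx' y t).symm
    rw [this]
    exact isOpen_interior.preimage (by fun_prop)
  · have : depth C x ⁻¹' Iio t = (fun y => y - t • x) ⁻¹' Cᶜ := by
      ext y
      simpa using (not_congr (hC.sub_smul_mem_iff hx hx' y t)).symm
    rw [this]
    exact hC.isClosed.isOpen_compl.preimage (by fun_prop)

/-- The trace on the unit sphere of a closed convex cone that has interior points and is not the
whole space is homeomorphic to a closed ball. -/
lemma exists_ball_param [FiniteDimensional ℝ V] {k : ℕ} (hk : Module.finrank ℝ V = k + 1) :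
    ∃ (χ : (Fin k → ℝ) → V) (ψ : V → (Fin k → ℝ)), Continuous χ ∧
      ContinuousOn ψ (C ∩ Metric.sphere 0 1) ∧
      (∀ b ∈ Metric.closedBall (0 : Fin k → ℝ) 1,
        χ b ∈ C ∩ Metric.sphere 0 1 ∧ ψ (χ b) = b) ∧
      (∀ y ∈ C ∩ Metric.sphere 0 1, ψ y ∈ Metric.closedBall 0 1 ∧ χ (ψ y) = y ∧
        (ψ y ∈ Metric.ball 0 1 ↔ y ∈ interior C)) := by
  have hx0 : x ≠ 0 := by
    rintro rfl
    exact hx' (by simpa using interior_subset hx)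
  obtain ⟨l, hl⟩ := SeparatingDual.exists_eq_one (R := ℝ) hx0
  have hrange : LinearMap.range (l : V →ₗ[ℝ] ℝ) = ⊤ :=
    LinearMap.range_eq_top.2 fun r => ⟨r • x, by simp [hl]⟩
  have hker : Module.finrank ℝ (LinearMap.ker (l : V →ₗ[ℝ] ℝ)) = Module.finrank ℝ (Fin k → ℝ) := by
    have := (l : V →ₗ[ℝ] ℝ).finrank_range_add_finrank_ker
    rw [hrange, hk] at this
    simp at this ⊢
    omega
  let e := ContinuousLinearEquiv.ofFinrankEq hker
  let pr : V →L[ℝ] LinearMap.ker (l : V →ₗ[ℝ] ℝ) :=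
    (ContinuousLinearMap.id ℝ V - l.smulRight x).codRestrict _ (by intro y; simp [hl])
  obtain ⟨inc, p, hpi, hpx, hli, hdec⟩ : ∃ (inc : (Fin k → ℝ) →L[ℝ] V) (p : V →L[ℝ] (Fin k → ℝ)),
      (∀ b, p (inc b) = b) ∧ p x = 0 ∧ (∀ b, l (inc b) = 0) ∧ ∀ y, y = inc (p y) + l y • x := by
    refine ⟨(Submodule.subtypeL _).comp e.symm.toContinuousLinearMap,
      e.toContinuousLinearMap.comp pr,
      fun b => ?_, ?_, fun b => ?_, fun y => ?_⟩
    · have : pr (e.symm b : V) = e.symm b := by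
        ext
        have := (e.symm b).2
        simp only [LinearMap.mem_ker] at this
        simp [pr, show l (e.symm b : V) = 0 from this]
      simp [this]
    · have : pr x = 0 := by ext; simp [pr, hl]
      simp [this]
    · exact (e.symm b).2
    · simp [pr]
  clear_value e pr
  let g := depth C x
  have hgc : Continuous g := hC.continuous_depth hx hx'
  -- The shift along `x` makes the depth exactly `1 - ‖b‖`, so `raw b ∈ C` iff `‖b‖ ≤ 1`, and it is
  -- interior iff `‖b‖ < 1`. The inverse rescales `y` so that `‖p y‖ + g y` becomes `1`.
  let raw : (Fin k → ℝ) → V := fun b => inc b + (1 - ‖b‖ - g (inc b)) • x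
  have hrawc : Continuous raw := by fun_prop
  have hgraw : ∀ b, g (raw b) = 1 - ‖b‖ := fun b => by
    simp only [raw, g, hC.depth_add_smul hx hx']; ring
  have hpraw : ∀ b, p (raw b) = b := fun b => by simp [raw, hpi, hpx]
  have hraw0 : ∀ b, raw b ≠ 0 := fun b hb => by
    have h1 := hpraw b
    have h2 := hgraw b
    rw [hb, map_zero] at h1
    rw [hb, ← h1] at h2
    simp [g, hC.depth_zero hx hx'] at h2
  have hrawn : ∀ b, 0 < ‖raw b‖ := fun b => norm_pos_iff.2 (hraw0 b)
  have hden : ∀ y ∈ C ∩ Metric.sphere (0 : V) 1, 0 < ‖p y‖ + g y := by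
    rintro y ⟨hyC, hyS⟩
    have hg0 : 0 ≤ g y := (hC.mem_iff_depth hx hx' y).1 hyC
    rcases hg0.lt_or_eq with h | h
    · have := norm_nonneg (p y); linarith
    -- If `p y = 0`, then `y = l y • x` has depth `l y`; depth zero would force `y = 0`.
    · rw [← h, add_zero, norm_pos_iff]
      intro hp
      have hy := hdec y
      rw [hp, map_zero] at hy
      have : g y = l y := by
        rw [hy]
        simp only [g]
        rw [hC.depth_add_smul hx hx', hC.depth_zero hx hx']
        simp [hl]
      rw [← this, ← h] at hy
      simp at hy
      simp [hy] at hyS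
  refine ⟨fun b => ‖raw b‖⁻¹ • raw b, fun y => (‖p y‖ + g y)⁻¹ • p y, ?_, ?_, ?_, ?_⟩
  · exact (hrawc.norm.inv₀ fun b => (hrawn b).ne').smul hrawc
  · refine ContinuousOn.smul (ContinuousOn.inv₀ (by fun_prop) fun y hy => (hden y hy).ne')
      (by fun_prop)
  · intro b hb
    have hb' : ‖b‖ ≤ 1 := by simpa using hb
    have hinv : 0 < ‖raw b‖⁻¹ := inv_pos.2 (hrawn b)
    refine ⟨⟨hC.smul_mem _ hinv _ ?_, ?_⟩, ?_⟩
    · rw [hC.mem_iff_depth hx hx']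
      have := hgraw b
      simp only [g] at this
      rw [this]; linarith
    · simp [norm_smul, (hrawn b).ne']
    · have h1 : p (‖raw b‖⁻¹ • raw b) = ‖raw b‖⁻¹ • b := by rw [map_smul, hpraw]
      have h2 : g (‖raw b‖⁻¹ • raw b) = ‖raw b‖⁻¹ * (1 - ‖b‖) := by
        rw [← hgraw]; exact hC.depth_smul hx hx' hinv _
      have h3 := (hrawn b).ne'
      simp only [h1, h2, norm_smul, norm_inv, norm_norm, smul_smul]
      rw [← mul_add]
      simp [h3]
  · intro y hy
    have hd := hden y hy
    have hg0 : 0 ≤ g y := (hC.mem_iff_depth hx hx' y).1 hy.1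
    have hyn : ‖y‖ = 1 := by simpa using hy.2
    set c := ‖p y‖ + g y with hc
    have hnorm : ‖c⁻¹ • p y‖ = c⁻¹ * ‖p y‖ := by
      rw [norm_smul, norm_inv, Real.norm_of_nonneg hd.le]
    have hrawy : raw (c⁻¹ • p y) = c⁻¹ • y := by
      have hgi : g y = g (inc (p y)) + l y := by
        conv_lhs => rw [hdec y]
        exact hC.depth_add_smul hx hx' _ _
      have hgs : g (c⁻¹ • inc (p y)) = c⁻¹ * g (inc (p y)) :=
        hC.depth_smul hx hx' (inv_pos.2 hd) _
      simp only [raw]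
      rw [hnorm, map_smul, hgs]
      conv_rhs => rw [hdec y]
      have : 1 - c⁻¹ * ‖p y‖ - c⁻¹ * g (inc (p y)) = c⁻¹ * l y := by
        rw [show g (inc (p y)) = g y - l y by linarith]
        field_simp
        rw [hc]; ring
      rw [this]
      module
    refine ⟨?_, ?_, ?_⟩
    · rw [mem_closedBall_zero_iff, hnorm, inv_mul_le_iff₀ hd]
      linarith
    · change ‖raw (c⁻¹ • p y)‖⁻¹ • raw (c⁻¹ • p y) = y
      rw [hrawy, norm_smul, hyn, norm_inv, Real.norm_of_nonneg hd.le, smul_smul]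
      simp [hd.ne']
    · rw [mem_ball_zero_iff, hnorm, inv_mul_lt_iff₀ hd, hC.mem_interior_iff_depth hx hx']
      simp only [g] at hc
      constructor <;> intro h <;> linarith

end IsClosedConvexCone

end ConeBall

end ConvexPartition

namespace ConvexPartition
open Set Filter Topology

/-! ### From conical covers to regular CW complexes -/

section Conical

variable {E ι : Type*} [NormedAddCommGroup E] [NormedSpace ℝ E]

/-- A cover by the closures of disjoint nonempty open convex cones. -/
structure IsConicalCover (O : ι → Set E) : Prop extends IsOpenConvexCover O where
  nonempty : ∀ i, (O i).Nonempty
  smul_mem : ∀ i, ∀ r : ℝ, 0 < r → ∀ y ∈ O i, r • y ∈ O i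

lemma smul_mem_closure {s : Set E} (hs : ∀ r : ℝ, 0 < r → ∀ y ∈ s, r • y ∈ s) {r : ℝ} (hr : 0 < r)
    {y : E} (hy : y ∈ closure s) : r • y ∈ closure s :=
  map_mem_closure (continuous_const_smul r) hy fun z hz => hs r hr z hz

lemma zero_mem_closure {s : Set E} (hs : ∀ r : ℝ, 0 < r → ∀ y ∈ s, r • y ∈ s) (hne : s.Nonempty) :
    (0 : E) ∈ closure s := by
  obtain ⟨y, hy⟩ := hne
  have hc : ContinuousAt (fun r : ℝ => r • y) 0 := by fun_prop
  have ht : Tendsto (fun r : ℝ => r • y) (𝓝[>] 0) (𝓝 0) := by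
    simpa using hc.tendsto.mono_left nhdsWithin_le_nhds
  refine mem_closure_of_tendsto ht ?_
  filter_upwards [self_mem_nhdsWithin] with r hr using hs r hr y hy

namespace IsConicalCover

variable {O : ι → Set E} (hO : IsConicalCover O)
include hO

lemma contact_zero : contact O 0 = univ :=
  eq_univ_of_forall fun i => zero_mem_closure (hO.smul_mem i) (hO.nonempty i)

lemma contact_smul {r : ℝ} (hr : 0 < r) (x : E) : contact O (r • x) = contact O x := by
  refine Subset.antisymm (fun i hi => ?_) fun i hi => smul_mem_closure (hO.smul_mem i) hr hi
  have := smul_mem_closure (hO.smul_mem i) (inv_pos.2 hr) hi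
  rwa [smul_smul, inv_mul_cancel₀ hr.ne', one_smul] at this

lemma zero_mem_stratum (x : E) : 0 ∈ stratum O x := by
  simp [stratum, hO.contact_zero]

lemma isClosedConvexCone_stratum (x : E) : IsClosedConvexCone (stratum O x) where
  isClosed := isClosed_stratum O x
  convex := hO.convex_stratum x
  smul_mem r hr y hy := by rwa [mem_stratum, hO.contact_smul hr]

variable [FiniteDimensional ℝ E] [Finite ι]

/-- If the spans agreed, `x` would lie in the span of `stratum O y`, where `y` is interior. One
could then move past `y` away from `x` within `stratum O x`, and `contact_eq_of_extend` would give
equal contact sets. -/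
lemma finrank_span_stratum_lt {x y : E} (hy : y ∈ stratum O x)
    (hne : contact O y ≠ contact O x) :
    Module.finrank ℝ (Submodule.span ℝ (stratum O y)) <
      Module.finrank ℝ (Submodule.span ℝ (stratum O x)) := by
  have hsub : stratum O y ⊆ stratum O x := fun z hz => Subset.trans hy hz
  refine Submodule.finrank_lt_finrank_of_lt
    (lt_of_le_of_ne (Submodule.span_mono hsub) fun heq => hne ?_)
  set V := Submodule.span ℝ (stratum O y)
  set C : Set V := (↑) ⁻¹' stratum O y
  have hxV : x ∈ V := by
    rw [heq]
    exact Submodule.subset_span (self_mem_stratum O x)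
  have hyV : y ∈ V := Submodule.subset_span (self_mem_stratum O y)
  have hyi : (⟨y, hyV⟩ : V) ∈ interior C :=
    (hO.mem_interior_stratum_iff (hO.zero_mem_stratum y) ⟨y, hyV⟩).2 rfl
  have hc : ContinuousAt (fun ε : ℝ => (⟨y, hyV⟩ : V) - ε • (⟨x, hxV⟩ - ⟨y, hyV⟩)) 0 := by fun_prop
  have hev : ∀ᶠ ε : ℝ in 𝓝 0, (⟨y, hyV⟩ : V) - ε • (⟨x, hxV⟩ - ⟨y, hyV⟩) ∈ interior C := by
    apply hc.eventually_mem
    simpa using isOpen_interior.mem_nhds hyi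
  obtain ⟨ε, hε, hε0⟩ := ((hev.filter_mono nhdsWithin_le_nhds).and
    (self_mem_nhdsWithin (s := Ioi (0 : ℝ)))).exists
  exact hO.contact_eq_of_extend hy hε0 (hsub (show _ ∈ C from interior_subset hε))

/-- The trace of a stratum on the unit sphere is a closed cell. -/
lemma exists_characteristic_map {x : E} (hx : contact O x ≠ univ) {k : ℕ}
    (hk : Module.finrank ℝ (Submodule.span ℝ (stratum O x)) = k + 1) :
    ∃ e : PartialEquiv (Fin k → ℝ) E, e.source = Metric.ball 0 1 ∧
      ContinuousOn e (Metric.closedBall 0 1) ∧ ContinuousOn e.symm e.target ∧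
      e '' Metric.ball 0 1 = {y | y ∈ Metric.sphere 0 1 ∧ contact O y = contact O x} ∧
      e '' Metric.closedBall 0 1 = stratum O x ∩ Metric.sphere 0 1 ∧
      InjOn e (Metric.closedBall 0 1) := by
  set V := Submodule.span ℝ (stratum O x) with hV
  set C : Set V := (↑) ⁻¹' stratum O x with hC
  have hint : ∀ y : V, y ∈ interior C ↔ contact O (y : E) = contact O x :=
    hO.mem_interior_stratum_iff (hO.zero_mem_stratum x)
  have hS := hO.isClosedConvexCone_stratum x
  have hCc : IsClosedConvexCone C :=
    ⟨hS.isClosed.preimage continuous_subtype_val, hS.convex.linear_preimage V.subtype,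
      fun r hr y hy => hS.smul_mem r hr y hy⟩
  have hxi : (⟨x, Submodule.subset_span (self_mem_stratum O x)⟩ : V) ∈ interior C :=
    (hint _).2 rfl
  have hneg := hCc.neg_notMem hxi fun h => hx (by
    rw [← (hint 0).1 h]
    exact hO.contact_zero)
  obtain ⟨χ, ψ, hχ, hψ, h1, h2⟩ := hCc.exists_ball_param hxi hneg hk
  -- Any linear retraction onto `V` serves to make the inverse total on `E`.
  obtain ⟨pr, hpr⟩ := LinearMap.exists_leftInverse_of_injective V.subtype V.ker_subtype
  have hprV : ∀ v : V, pr (v : E) = v := fun v => congrArg (fun f => f v) hpr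
  have hball : ∀ b ∈ Metric.ball (0 : Fin k → ℝ) 1,
      (χ b : E) ∈ Metric.sphere (0 : E) 1 ∧ contact O (χ b : E) = contact O x := by
    intro b hb
    obtain ⟨hm, hb'⟩ := h1 b (Metric.ball_subset_closedBall hb)
    refine ⟨by simpa using hm.2, (hint _).1 ?_⟩
    rw [← (h2 _ hm).2.2, hb']
    exact hb
  have hlift : ∀ y ∈ stratum O x ∩ Metric.sphere 0 1, ∃ v : V, (v : E) = y ∧
      v ∈ C ∩ Metric.sphere 0 1 := fun y hy =>
    ⟨⟨y, Submodule.subset_span hy.1⟩, rfl, hy.1, by simpa using hy.2⟩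
  let e : PartialEquiv (Fin k → ℝ) E :=
    { toFun := fun b => χ b
      invFun := fun y => ψ (pr y)
      source := Metric.ball 0 1
      target := {y | y ∈ Metric.sphere 0 1 ∧ contact O y = contact O x}
      map_source' := hball
      map_target' := by
        rintro y ⟨hyS, hy⟩
        obtain ⟨v, rfl, hv⟩ := hlift y ⟨hy.ge, hyS⟩
        rw [hprV]
        exact (h2 v hv).2.2.2 ((hint v).2 hy)
      left_inv' := fun b hb => by
        rw [hprV]
        exact (h1 b (Metric.ball_subset_closedBall hb)).2
      right_inv' := by
        rintro y ⟨hyS, hy⟩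
        obtain ⟨v, rfl, hv⟩ := hlift y ⟨hy.ge, hyS⟩
        rw [hprV, (h2 v hv).2.1] }
  have hinj : InjOn e (Metric.closedBall 0 1) := by
    intro a ha b hb hab
    rw [← (h1 a ha).2, ← (h1 b hb).2, Subtype.ext (show (χ a : E) = χ b from hab)]
  refine ⟨e, rfl, (continuous_subtype_val.comp hχ).continuousOn, ?_, ?_, ?_, hinj⟩
  · refine hψ.comp (LinearMap.continuous_of_finiteDimensional pr).continuousOn ?_
    rintro y ⟨hyS, hy⟩
    obtain ⟨v, rfl, hv⟩ := hlift y ⟨hy.ge, hyS⟩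
    rwa [hprV]
  · exact e.image_source_eq_target
  · ext y
    constructor
    · rintro ⟨b, hb, rfl⟩
      obtain ⟨hm, -⟩ := h1 b hb
      exact ⟨hm.1, by simpa using hm.2⟩
    · intro hy
      obtain ⟨v, rfl, hv⟩ := hlift y hy
      exact ⟨ψ v, (h2 v hv).1, congrArg Subtype.val (h2 v hv).2.1⟩

/-- The traces of the strata on the unit sphere are the closed cells of a regular CW complex. -/
theorem exists_regular_cwComplex (A : Set ι)
    (hA : ∀ x ∈ Metric.sphere (0 : E) 1, contact O x ≠ univ) {D : Set E}
    (hD : D = Metric.sphere 0 1 ∩ ⋃ i ∈ A, closure (O i)) :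
    ∃ cw : Topology.CWComplex D, IsRegularCW D ∧
      BijOn (fun e : (Σ k : ℕ, Topology.RelCWComplex.cell D k) =>
        Topology.RelCWComplex.closedCell e.1 e.2) univ
        {F | ∃ x ∈ D, F = stratum O x ∩ Metric.sphere 0 1} := by
  have hDS : ∀ x ∈ D, x ∈ Metric.sphere (0 : E) 1 := fun x hx => (hD ▸ hx).1
  have hsub : ∀ x ∈ D, stratum O x ∩ Metric.sphere 0 1 ⊆ D := by
    intro x hx y hy
    rw [hD] at hx ⊢
    obtain ⟨i, hi, hxi⟩ := mem_iUnion₂.1 hx.2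
    exact ⟨hy.2, mem_iUnion₂.2 ⟨i, hi, hy.1 hxi⟩⟩
  have hcontact : ∀ x ∈ D, ∀ y ∈ D, stratum O x ∩ Metric.sphere 0 1 =
      stratum O y ∩ Metric.sphere 0 1 → contact O x = contact O y := by
    intro x hx y hy h
    have h1 : x ∈ stratum O y ∩ Metric.sphere 0 1 := h ▸ ⟨self_mem_stratum O x, hDS x hx⟩
    have h2 : y ∈ stratum O x ∩ Metric.sphere 0 1 := h ▸ ⟨self_mem_stratum O y, hDS y hy⟩
    exact Subset.antisymm h2.1 h1.1
  have hrank : ∀ x ∈ D, ∃ k, Module.finrank ℝ (Submodule.span ℝ (stratum O x)) = k + 1 := by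
    intro x hx
    refine Nat.exists_eq_succ_of_ne_zero fun h => ?_
    rw [Submodule.finrank_eq_zero, Submodule.span_eq_bot] at h
    have := hDS x hx
    rw [h x (self_mem_stratum O x)] at this
    simp at this
  -- A cone of dimension `k + 1` cuts the sphere in a `k`-cell. Cells are sets, not base points, so
  -- points with equal contact sets give a single cell.
  let cell : ℕ → Type _ := fun k => {F : Set E // ∃ x ∈ D, F = stratum O x ∩ Metric.sphere 0 1 ∧
    Module.finrank ℝ (Submodule.span ℝ (stratum O x)) = k + 1}
  choose pt hptD hptF hptk using fun k (F : cell k) => F.2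
  choose e hsource hcont hsymm hopen hclosed hinj using fun k (F : cell k) =>
    hO.exists_characteristic_map (hA _ (hDS _ (hptD k F))) (hptk k F)
  have hclosed' : ∀ k F, e k F '' Metric.closedBall 0 1 = F.1 := fun k F => by
    rw [hclosed, ← hptF]
  have hcell : ∀ x ∈ D, ∃ k, ∃ F : cell k,
      k + 1 = Module.finrank ℝ (Submodule.span ℝ (stratum O x)) ∧
      F.1 = stratum O x ∩ Metric.sphere 0 1 := by
    intro x hx
    obtain ⟨k, hk⟩ := hrank x hx
    exact ⟨k, ⟨_, x, hx, rfl, hk⟩, hk.symm, rfl⟩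
  have hsigma : ∀ a b : Σ k, cell k, contact O (pt a.1 a.2) = contact O (pt b.1 b.2) → a = b := by
    rintro ⟨k, F⟩ ⟨m, G⟩ h
    have hs := stratum_congr h
    obtain rfl : k = m := by
      have h1 := hptk k F
      have h2 := hptk m G
      simp only at hs
      rw [hs, h2] at h1
      omega
    have : F = G := Subtype.ext (by rw [hptF k F, hptF k G]; exact congrArg (· ∩ _) hs)
    rw [this]
  let cw : Topology.CWComplex D := Topology.CWComplex.mkFinite D cell e
    (by
      filter_upwards [eventually_ge_atTop (Module.finrank ℝ E)] with k hk
      refine ⟨fun F => ?_⟩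
      have h1 := hptk k F
      have h2 := Submodule.finrank_le (Submodule.span ℝ (stratum O (pt k F)))
      omega)
    (fun k => Finite.of_injective (fun F : cell k => contact O (pt k F)) fun F G h => by
      have := hsigma ⟨k, F⟩ ⟨k, G⟩ h
      simpa using this)
    hsource hcont hsymm
    (by
      intro a _ b _ hab
      refine disjoint_left.2 fun y hya hyb => hab (hsigma a b ?_)
      simp only [hopen] at hya hyb
      exact hya.2.symm.trans hyb.2)
    (by
      intro k F b hb
      have hbc : b ∈ Metric.closedBall (0 : Fin k → ℝ) 1 := Metric.sphere_subset_closedBall hb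
      have hy : e k F b ∈ stratum O (pt k F) ∩ Metric.sphere 0 1 :=
        hclosed k F ▸ mem_image_of_mem _ hbc
      -- With an equal contact set, the boundary point would also be the image of a point of the
      -- open ball, against injectivity on the closed ball.
      have hne : contact O (e k F b) ≠ contact O (pt k F) := by
        intro h
        have hmem : e k F b ∈ e k F '' Metric.ball 0 1 := by
          rw [hopen]
          exact ⟨hy.2, h⟩
        obtain ⟨a, ha, hab⟩ := hmem
        have := hinj k F (Metric.ball_subset_closedBall ha) hbc hab
        rw [this] at ha
        simp only [mem_sphere_zero_iff_norm, mem_ball_zero_iff] at ha hb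
        linarith
      obtain ⟨m, G, hm, hG⟩ := hcell _ (hsub _ (hptD k F) hy)
      have hlt := hO.finrank_span_stratum_lt hy.1 hne
      rw [← hm, hptk k F] at hlt
      refine mem_iUnion₂.2 ⟨m, by omega, mem_iUnion.2 ⟨G, ?_⟩⟩
      rw [hclosed', hG]
      exact ⟨self_mem_stratum O _, hy.2⟩)
    (by
      refine Subset.antisymm (iUnion₂_subset fun k F => ?_) fun y hy => ?_
      · rw [hclosed]
        exact hsub _ (hptD k F)
      · obtain ⟨m, G, -, hG⟩ := hcell y hy
        refine mem_iUnion₂.2 ⟨m, G, ?_⟩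
        rw [hclosed', hG]
        exact ⟨self_mem_stratum O _, hDS y hy⟩)
  refine ⟨cw, fun k F => hinj k F, fun a _ => ⟨pt a.1 a.2, hptD a.1 a.2, hclosed a.1 a.2⟩, ?_, ?_⟩
  · intro a _ b _ hab
    refine hsigma a b (hcontact _ (hptD a.1 a.2) _ (hptD b.1 b.2) ?_)
    have : e a.1 a.2 '' Metric.closedBall 0 1 = e b.1 b.2 '' Metric.closedBall 0 1 := hab
    rwa [hclosed, hclosed] at this
  · rintro F ⟨x, hx, rfl⟩
    obtain ⟨m, G, -, hG⟩ := hcell x hx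
    refine ⟨⟨m, G⟩, mem_univ _, ?_⟩
    change e m G '' Metric.closedBall 0 1 = _
    rw [hclosed', hG]

end IsConicalCover

end Conical

end ConvexPartition

namespace ConvexPartition
open Set Filter Topology

/-! ### Radial projection to the sphere -/

section Radial

variable {E : Type*} [NormedAddCommGroup E] [NormedSpace ℝ E] {s : Set E}

lemma normalize_mem (hs : ∀ r : ℝ, 0 < r → ∀ y ∈ s, r • y ∈ s) (h0 : (0 : E) ∉ s) {y : E}
    (hy : y ∈ s) : ‖y‖⁻¹ • y ∈ Metric.sphere 0 1 ∩ s := by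
  have hy0 : 0 < ‖y‖ := norm_pos_iff.2 fun h => h0 (h ▸ hy)
  exact ⟨by simp [norm_smul, hy0.ne'], hs _ (inv_pos.2 hy0) _ hy⟩

lemma closure_sphere_inter (hs : ∀ r : ℝ, 0 < r → ∀ y ∈ s, r • y ∈ s) (h0 : (0 : E) ∉ s) :
    closure (Metric.sphere 0 1 ∩ s) = Metric.sphere 0 1 ∩ closure s := by
  refine Subset.antisymm (subset_inter ?_ (closure_mono inter_subset_right)) ?_
  · exact closure_minimal inter_subset_left Metric.isClosed_sphere
  · rintro y ⟨hyS, hy⟩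
    have hy1 : ‖y‖ = 1 := by simpa using hyS
    -- Normalization is continuous at `y`, fixes it, and maps `s` into its trace on the sphere.
    have hc : ContinuousAt (fun z : E => ‖z‖⁻¹ • z) y :=
      (continuousAt_id.norm.inv₀ (by simp [hy1])).smul continuousAt_id
    have := hc.continuousWithinAt.mem_closure_image hy
    simp only [hy1, inv_one, one_smul] at this
    refine closure_mono ?_ this
    rintro _ ⟨z, hz, rfl⟩
    exact normalize_mem hs h0 hz

end Radial

/-! ### Cones over the spherical representation -/

section Spherical

variable {d n : ℕ}

lemma upperHemisphere_eq : upperHemisphere d = Metric.sphere 0 1 ∩ {v | 0 < v 0} := rfl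

lemma cone_sphere_inter_closure {s : Set (EuclideanSpace ℝ (Fin (d + 1)))}
    (hs : ∀ r : ℝ, 0 < r → ∀ y ∈ s, r • y ∈ s) (h0 : 0 ∉ s) (hne : s.Nonempty) :
    cone (Metric.sphere 0 1 ∩ closure s) = closure s := by
  ext v
  constructor
  · rintro ⟨r, hr, a, ha, rfl⟩
    rcases hr.eq_or_lt with rfl | hr
    · simpa using zero_mem_closure hs hne
    · exact smul_mem_closure hs hr ha.2
  · intro hv
    by_cases hv0 : v = 0
    · obtain ⟨y, hy⟩ := hne
      have := normalize_mem hs h0 hy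
      exact ⟨0, le_rfl, _, ⟨this.1, subset_closure this.2⟩, by simp [hv0]⟩
    · have hpos : 0 < ‖v‖ := norm_pos_iff.2 hv0
      exact ⟨‖v‖, hpos.le, ‖v‖⁻¹ • v, ⟨by simp [norm_smul, hpos.ne'],
        smul_mem_closure hs (inv_pos.2 hpos) hv⟩, by simp [smul_smul, hpos.ne']⟩

/-- The last `d` coordinates of a point of `ℝ^{d+1}`. -/
noncomputable def tail (v : EuclideanSpace ℝ (Fin (d + 1))) : EuclideanSpace ℝ (Fin d) :=
  WithLp.toLp 2 fun j => v j.succ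

/-- The point `(1, x)` of `ℝ^{d+1}`. -/
noncomputable def lift (x : EuclideanSpace ℝ (Fin d)) : EuclideanSpace ℝ (Fin (d + 1)) :=
  WithLp.toLp 2 (Fin.cons (1 : ℝ) (fun i => x i))

@[simp] lemma tail_apply (v : EuclideanSpace ℝ (Fin (d + 1))) (j : Fin d) :
    tail v j = v j.succ := rfl

@[simp] lemma lift_zero_apply (x : EuclideanSpace ℝ (Fin d)) : lift x 0 = 1 := rfl

@[simp] lemma lift_succ_apply (x : EuclideanSpace ℝ (Fin d)) (j : Fin d) :
    lift x j.succ = x j := rfl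

lemma tail_add (v w : EuclideanSpace ℝ (Fin (d + 1))) : tail (v + w) = tail v + tail w := rfl

lemma tail_smul (r : ℝ) (v : EuclideanSpace ℝ (Fin (d + 1))) : tail (r • v) = r • tail v := rfl

@[simp] lemma tail_lift (x : EuclideanSpace ℝ (Fin d)) : tail (lift x) = x := rfl

@[fun_prop] lemma continuous_tail :
    Continuous (tail : EuclideanSpace ℝ (Fin (d + 1)) → EuclideanSpace ℝ (Fin d)) := by
  unfold tail
  fun_prop

@[fun_prop] lemma continuous_lift :
    Continuous (lift : EuclideanSpace ℝ (Fin d) → EuclideanSpace ℝ (Fin (d + 1))) := by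
  refine (PiLp.continuous_toLp 2 _).comp (continuous_pi fun j => ?_)
  refine Fin.cases ?_ (fun j => ?_) j
  · simpa using continuous_const
  · simp only [Fin.cons_succ]
    fun_prop

lemma smul_lift_inv_smul_tail {v : EuclideanSpace ℝ (Fin (d + 1))} (hv : v 0 ≠ 0) :
    v 0 • lift ((v 0)⁻¹ • tail v) = v := by
  ext j
  refine Fin.cases ?_ (fun j => ?_) j
  · simp
  · simp [hv]

lemma norm_lift (x : EuclideanSpace ℝ (Fin d)) : ‖lift x‖ = Real.sqrt (1 + ‖x‖ ^ 2) := by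
  rw [EuclideanSpace.norm_eq, EuclideanSpace.norm_sq_eq, Fin.sum_univ_succ]
  simp

lemma hat_eq (x : EuclideanSpace ℝ (Fin d)) : hat x = ‖lift x‖⁻¹ • lift x := by
  rw [norm_lift, ← one_div]
  rfl

/-- The open cones over the regions of the spherical representation. -/
def openCone (P : Fin n → Set (EuclideanSpace ℝ (Fin d))) :
    Option (Fin n) → Set (EuclideanSpace ℝ (Fin (d + 1)))
  | some i => {v | 0 < v 0 ∧ (v 0)⁻¹ • tail v ∈ P i}
  | none => {v | v 0 < 0}

variable {P : Fin n → Set (EuclideanSpace ℝ (Fin d))}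

lemma zero_notMem_openCone (i : Option (Fin n)) : 0 ∉ openCone P i := by
  cases i <;> simp [openCone]

lemma smul_mem_openCone (i : Option (Fin n)) (r : ℝ) (hr : 0 < r)
    (y : EuclideanSpace ℝ (Fin (d + 1))) (hy : y ∈ openCone P i) : r • y ∈ openCone P i := by
  cases i with
  | none =>
    have hy' : y 0 < 0 := hy
    exact mul_neg_of_pos_of_neg hr hy'
  | some i =>
    obtain ⟨h1, h2⟩ := hy
    refine ⟨mul_pos hr h1, ?_⟩
    have : ((r • y) 0)⁻¹ • tail (r • y) = (y 0)⁻¹ • tail y := by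
      rw [tail_smul, smul_smul, PiLp.smul_apply, smul_eq_mul]
      congr 1
      field_simp
    rwa [this]

lemma lift_mem_openCone {i : Fin n} {x : EuclideanSpace ℝ (Fin d)} (hx : x ∈ P i) :
    lift x ∈ openCone P (some i) := by
  simpa [openCone] using hx

lemma sphericalRep_eq (i : Option (Fin n)) :
    sphericalRep P i = Metric.sphere 0 1 ∩ openCone P i := by
  cases i with
  | none => rfl
  | some i =>
    ext v
    constructor
    · rintro ⟨x, hx, rfl⟩
      rw [hat_eq]
      exact normalize_mem (smul_mem_openCone _) (zero_notMem_openCone _) (lift_mem_openCone hx)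
    · rintro ⟨hv, h0, hP⟩
      refine ⟨_, hP, ?_⟩
      have hv1 : ‖v‖ = 1 := by simpa using hv
      have h1 := smul_lift_inv_smul_tail h0.ne'
      have h2 : v 0 * ‖lift ((v 0)⁻¹ • tail v)‖ = 1 := by
        rw [← hv1]
        conv_rhs => rw [← h1]
        rw [norm_smul, Real.norm_of_nonneg h0.le]
      rw [hat_eq, ← eq_inv_of_mul_eq_one_left h2, h1]

namespace IsConvexPartition

variable (hP : IsConvexPartition P)
include hP

lemma nonempty_openCone (i : Option (Fin n)) : (openCone P i).Nonempty := by
  cases i with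
  | none => exact ⟨-lift 0, by simp [openCone]⟩
  | some i =>
    obtain ⟨x, hx⟩ := hP.nonempty i
    exact ⟨_, lift_mem_openCone hx⟩

lemma convex_openCone (i : Option (Fin n)) : Convex ℝ (openCone P i) := by
  cases i with
  | none =>
    exact (convex_Iio (0 : ℝ)).linear_preimage
      (EuclideanSpace.proj (𝕜 := ℝ) (0 : Fin (d + 1))).toLinearMap
  | some i =>
    rintro v ⟨hv0, hv⟩ w ⟨hw0, hw⟩ a b ha hb hab
    have hpos : 0 < a * v 0 + b * w 0 := by
      rcases ha.eq_or_lt with rfl | ha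
      · obtain rfl : b = 1 := by linarith
        simpa using hw0
      · have := mul_pos ha hv0
        have := mul_nonneg hb hw0.le
        linarith
    refine ⟨by simpa using hpos, ?_⟩
    -- Central projection to height one sends segments to segments, with weights rescaled by the
    -- heights of the endpoints.
    have h := hP.convex i hv hw (a := a * v 0 / (a * v 0 + b * w 0))
      (b := b * w 0 / (a * v 0 + b * w 0)) (by positivity) (by positivity) (by field_simp)
    convert h using 1
    simp only [tail_add, tail_smul, PiLp.add_apply, PiLp.smul_apply, smul_eq_mul]
    match_scalars <;> field_simp

lemma isOpen_openCone (i : Option (Fin n)) : IsOpen (openCone P i) := by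
  cases i with
  | none => exact isOpen_lt (by fun_prop) continuous_const
  | some i =>
    have hpos : IsOpen {v : EuclideanSpace ℝ (Fin (d + 1)) | 0 < v 0} :=
      isOpen_lt continuous_const (by fun_prop)
    have h0 : Continuous fun v : EuclideanSpace ℝ (Fin (d + 1)) => v 0 := by fun_prop
    have hc : ContinuousOn (fun v : EuclideanSpace ℝ (Fin (d + 1)) => (v 0)⁻¹ • tail v)
        {v | 0 < v 0} :=
      (h0.continuousOn.inv₀ fun v (hv : 0 < v 0) => hv.ne').smul continuous_tail.continuousOn
    exact hc.isOpen_inter_preimage hpos (hP.isOpen i)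

lemma disjoint_openCone : Pairwise fun i j => Disjoint (openCone P i) (openCone P j) := by
  intro i j hij
  refine disjoint_left.2 fun v hi hj => ?_
  cases i with
  | none =>
    cases j with
    | none => exact hij rfl
    | some j => exact lt_asymm hj.1 hi
  | some i =>
    cases j with
    | none => exact lt_asymm hi.1 hj
    | some j =>
      exact disjoint_left.1 (hP.pairwise_disjoint fun h => hij (congrArg some h)) hi.2 hj.2

lemma exists_mem_closure_of_pos {v : EuclideanSpace ℝ (Fin (d + 1))} (hv : 0 < v 0) :
    ∃ i, v ∈ closure (openCone P (some i)) := by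
  have hx : (v 0)⁻¹ • tail v ∈ ⋃ i, closure (P i) := hP.iUnion_closure ▸ mem_univ _
  obtain ⟨i, hi⟩ := mem_iUnion.1 hx
  refine ⟨i, ?_⟩
  rw [← smul_lift_inv_smul_tail hv.ne']
  exact map_mem_closure (f := fun x => v 0 • lift x) (by fun_prop) hi fun x hx =>
    smul_mem_openCone _ _ hv _ (lift_mem_openCone hx)

lemma iUnion_closure_some :
    ⋃ i, closure (openCone P (some i)) = closure {v | 0 < v 0} := by
  refine Subset.antisymm (iUnion_subset fun i => closure_mono fun v hv => hv.1) ?_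
  refine closure_minimal (fun v hv => ?_) (isClosed_iUnion_of_finite fun _ => isClosed_closure)
  exact mem_iUnion.2 (hP.exists_mem_closure_of_pos hv)

lemma isConicalCover : IsConicalCover (openCone P) where
  isOpen := hP.isOpen_openCone
  convex := hP.convex_openCone
  disjoint := hP.disjoint_openCone
  nonempty := hP.nonempty_openCone
  smul_mem := smul_mem_openCone
  cover := by
    refine eq_univ_of_forall fun v => mem_iUnion.2 ?_
    rcases lt_or_ge 0 (v 0) with h | h
    · obtain ⟨i, hi⟩ := hP.exists_mem_closure_of_pos h
      exact ⟨some i, hi⟩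
    · refine ⟨none, ?_⟩
      have hc : ContinuousAt (fun t : ℝ => v - t • lift (0 : EuclideanSpace ℝ (Fin d))) 0 := by
        fun_prop
      have ht : Tendsto (fun t : ℝ => v - t • lift (0 : EuclideanSpace ℝ (Fin d))) (𝓝[>] 0)
          (𝓝 v) := by
        simpa using hc.tendsto.mono_left nhdsWithin_le_nhds
      refine mem_closure_of_tendsto ht ?_
      filter_upwards [self_mem_nhdsWithin] with t ht
      have ht' : 0 < t := ht
      change (v - t • lift (0 : EuclideanSpace ℝ (Fin d))) 0 < 0
      simp only [PiLp.sub_apply, PiLp.smul_apply, lift_zero_apply, smul_eq_mul, mul_one]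
      linarith

omit hP in
lemma closure_sphericalRep (i : Option (Fin n)) :
    closure (sphericalRep P i) = Metric.sphere 0 1 ∩ closure (openCone P i) := by
  rw [sphericalRep_eq, closure_sphere_inter (smul_mem_openCone i) (zero_notMem_openCone i)]

lemma indexSet_eq (x : EuclideanSpace ℝ (Fin (d + 1))) :
    indexSet (sphericalRep P) x = contact (openCone P) x := by
  ext i
  change x ∈ cone (closure (sphericalRep P i)) ↔ x ∈ closure (openCone P i)
  rw [closure_sphericalRep, cone_sphere_inter_closure (smul_mem_openCone i)
    (zero_notMem_openCone i) (hP.nonempty_openCone i)]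

lemma sphericalFace_indexSet (x : EuclideanSpace ℝ (Fin (d + 1))) :
    sphericalFace (sphericalRep P) (indexSet (sphericalRep P) x) =
      stratum (openCone P) x ∩ Metric.sphere 0 1 := by
  rw [hP.indexSet_eq, sphericalFace, stratum_eq_iInter]
  ext y
  simp only [unitSphere, closure_sphericalRep, mem_inter_iff, mem_iInter]
  exact ⟨fun h => ⟨fun i hi => (h.2 i hi).2, h.1⟩, fun h => ⟨h.2, fun i hi => ⟨h.2, h.1 i hi⟩⟩⟩

lemma closure_upperHemisphere : closure (upperHemisphere d) =
    Metric.sphere 0 1 ∩ ⋃ i ∈ range (some : Fin n → Option (Fin n)), closure (openCone P i) := by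
  rw [biUnion_range, hP.iUnion_closure_some, upperHemisphere_eq, closure_sphere_inter]
  · intro r hr y hy
    exact mul_pos hr hy
  · simp

/-- The origin touches every cone, so `F_{I(0)}` contains every unit vector touching all of them. -/
lemma contact_ne_univ (hess : IsEssential P) {x : EuclideanSpace ℝ (Fin (d + 1))}
    (hx : x ∈ Metric.sphere 0 1) : contact (openCone P) x ≠ univ := by
  intro h
  have : x ∈ sphericalFace (sphericalRep P) (indexSet (sphericalRep P) 0) := by
    rw [hP.sphericalFace_indexSet]
    exact ⟨by rw [mem_stratum, h]; exact subset_univ _, hx⟩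
  rw [hess] at this
  exact this

lemma contact_ne_singleton_iff (x : EuclideanSpace ℝ (Fin (d + 1))) :
    contact (openCone P) x ≠ {none} ↔ ∃ i, x ∈ closure (openCone P (some i)) := by
  have hx : x ∈ ⋃ i, closure (openCone P i) := hP.isConicalCover.cover ▸ mem_univ _
  obtain ⟨j, hj⟩ := mem_iUnion.1 hx
  constructor
  · contrapose!
    intro h
    ext i
    cases i with
    | some i => simpa [contact] using h i
    | none =>
      cases j with
      | some j => exact absurd hj (h j)
      | none => simpa [contact] using hj
  · rintro ⟨i, hi⟩ h
    have : some i ∈ contact (openCone P) x := hi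
    rw [h] at this
    simp at this

/-- Excluding the index set `{∞}` means touching some cone over a region of `P`, which for unit
vectors is membership in the closed upper hemisphere. Essentiality rules out `x = 0`, so `x` can be
normalized without changing its stratum. -/
lemma nonempty_faces_eq (hess : IsEssential P) :
    {F | F ∈ faces P ∧ F.Nonempty} = {F | ∃ x ∈ closure (upperHemisphere d),
      F = stratum (openCone P) x ∩ Metric.sphere 0 1} := by
  have hO := hP.isConicalCover
  ext F
  constructor
  · rintro ⟨⟨x, hx, rfl⟩, hne⟩
    rw [hP.sphericalFace_indexSet] at hne ⊢
    rw [hP.indexSet_eq, hP.contact_ne_singleton_iff] at hx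
    have hx0 : x ≠ 0 := by
      rintro rfl
      rw [← hP.sphericalFace_indexSet, hess] at hne
      exact not_nonempty_empty hne
    have hpos : 0 < ‖x‖⁻¹ := inv_pos.2 (norm_pos_iff.2 hx0)
    refine ⟨‖x‖⁻¹ • x, ?_, by rw [stratum_congr (hO.contact_smul hpos x)]⟩
    rw [hP.closure_upperHemisphere, biUnion_range]
    obtain ⟨i, hi⟩ := hx
    exact ⟨by simp [norm_smul, hx0],
      mem_iUnion.2 ⟨i, smul_mem_closure (smul_mem_openCone _) hpos hi⟩⟩
  · rintro ⟨x, hx, rfl⟩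
    rw [hP.closure_upperHemisphere, biUnion_range] at hx
    refine ⟨⟨x, ?_, (hP.sphericalFace_indexSet x).symm⟩, x, self_mem_stratum _ x, hx.1⟩
    rw [hP.indexSet_eq, hP.contact_ne_singleton_iff]
    exact mem_iUnion.1 hx.2

end IsConvexPartition

end Spherical

end ConvexPartition

/-- The faces of an essential `n`-partition form a regular CW complex whose underlying space is the
closed upper hemisphere: there is a regular CW structure on that hemisphere such that
`e ↦ closed cell of e` is a bijection from the cells to the nonempty faces. -/
theorem theorem2p9 (d n : ℕ) (hd : 0 < d) (hn : 0 < n)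
    (P : Fin n → Set (EuclideanSpace ℝ (Fin d)))
    (hP : ConvexPartition.IsConvexPartition P)
    (hess : ConvexPartition.IsEssential P) :
    ∃ cw : Topology.CWComplex (closure (ConvexPartition.upperHemisphere d)),
      ConvexPartition.IsRegularCW (closure (ConvexPartition.upperHemisphere d)) ∧
      Set.BijOn
        (fun e : (Σ k : ℕ, Topology.RelCWComplex.cell
            (closure (ConvexPartition.upperHemisphere d)) k) =>
          Topology.RelCWComplex.closedCell e.1 e.2)
        Set.univ
        {F | F ∈ ConvexPartition.faces P ∧ F.Nonempty} := by
  rw [hP.nonempty_faces_eq hess]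
  exact hP.isConicalCover.exists_regular_cwComplex (Set.range some)
    (fun x hx => hP.contact_ne_univ hess hx) hP.closure_upperHemisphere
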